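/- Let $k$ be a field of characteristic $0$ and $R=k[[x,y]]$. For a proper ideal $J\subset R$ let $\mathfrak n$ be the maximal ideal of $R/J$ and let $\operatorname{HF}_{R/J}(i)=\dim_k \mathfrak n^i/\mathfrak n^{i+1}$, $i\ge 0$, be its Hilbert function. An ideal $J$ of $R$ is called zero-dimensional if it is proper and $\dim_k R/J<\infty$; a zero-dimensional ideal is a complete intersection if its minimal number of generators is $2$. Let $h:\mathbb N\to\mathbb N$ be the Hilbert function of $R/J_0$ for some zero-dimensional ideal $J_0\subset R$; thus $h$ vanishes for large arguments. Let $$\Delta(h)=\max\{|h(i)-h(i-1)| : i\ge 1\}$$ be its maximal jump, where the final drop of $h$ to $0$ counts as a jump. Then $h$ admits a complete intersection, that is, there is a complete intersection ideal $J\subset R$ with $\operatorname{HF}_{R/J}=h$, if and only if $\Delta(h)=1$. -/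

import Mathlib

/-- The ring `k[[x, y]]` of formal power series in two variables. -/
abbrev PowerSeriesTwo (k : Type*) [Field k] : Type _ := MvPowerSeries (Fin 2) k

/-- The maximal ideal of the local ring `k[[x, y]] / J` (for a proper ideal `J`),
that is, the image of the maximal ideal `(x, y)` of `k[[x, y]]`. -/
noncomputable def quotientMaximalIdeal {k : Type*} [Field k] (J : Ideal (PowerSeriesTwo k)) :
    Ideal (PowerSeriesTwo k ⧸ J) :=
  (IsLocalRing.maximalIdeal (PowerSeriesTwo k)).map (Ideal.Quotient.mk J)

/-- The (local) Hilbert function of `A = k[[x, y]] / J`, namely `i ↦ dim_k (𝔫 ^ i / 𝔫 ^ (i + 1))`,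
where `𝔫` is the maximal ideal of `A`. -/
noncomputable def localHilbertFunction {k : Type*} [Field k] (J : Ideal (PowerSeriesTwo k))
    (i : ℕ) : ℕ :=
  Module.finrank k
    (↥((quotientMaximalIdeal J ^ i).restrictScalars k) ⧸
      Submodule.submoduleOf ((quotientMaximalIdeal J ^ (i + 1)).restrictScalars k)
        ((quotientMaximalIdeal J ^ i).restrictScalars k))

/-- Zero-dimensional ideals of `k[[x, y]]`: proper ideals of finite colength. -/
def IsZeroDimensionalIdeal {k : Type*} [Field k] (J : Ideal (PowerSeriesTwo k)) : Prop :=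
  J ≠ ⊤ ∧ Module.Finite k (PowerSeriesTwo k ⧸ J)

/-- The minimal number of generators `μ(J)` of an ideal `J` of `k[[x, y]]`. -/
noncomputable def minGenerators {k : Type*} [Field k] (J : Ideal (PowerSeriesTwo k)) : ℕ :=
  Submodule.spanFinrank J

/-- Zero-dimensional complete intersection ideals of `k[[x, y]]`: as the ring has dimension two,
these are the zero-dimensional ideals that are minimally generated by two elements. -/
def IsCompleteIntersectionIdeal {k : Type*} [Field k] (J : Ideal (PowerSeriesTwo k)) : Prop :=
  IsZeroDimensionalIdeal J ∧ minGenerators J = 2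

/-- `h` is an admissible Hilbert function: it is the Hilbert function of `k[[x, y]] / J` for some
zero-dimensional ideal `J`. -/
def IsAdmissibleHilbertFunction (k : Type*) [Field k] (h : ℕ → ℕ) : Prop :=
  ∃ J : Ideal (PowerSeriesTwo k), IsZeroDimensionalIdeal J ∧ localHilbertFunction J = h

/-- The maximal jump `Δ(h) = max {|h i - h (i - 1)| : i ≥ 1}`. The supremum is a maximum as soon
as `h` has finite support; the final drop of `h` to `0` is one of the jumps. -/
noncomputable def maxJump (h : ℕ → ℕ) : ℕ :=
  ⨆ i : ℕ, ((h (i + 1) : ℤ) - (h i : ℤ)).natAbs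

/-! Write `L_J(i)` for the colength of `J + 𝔪 ^ i`; the Hilbert function of `R / J` is its first
difference. Since `k` is infinite, an element `f ∈ J` of minimal order `d` has a leading form prime
to some linear form `v` (`finite_setOf_mem_sup_span`), so `f = v w + e u ^ d` with `e` a unit.

Necessity: if `J = (f, b)`, subtracting a multiple of `f` from `b` gives `J = (f, v g)`. The colon
of `J + 𝔪 ^ (i + 1)` by `v` is `(f, g) + 𝔪 ^ i`, so `L_J(i + 1) = L_{(f,g)}(i) + min (i + 1) d`.
Taking the colon by `g` instead gives `L_J(i) = L_{(f,g)}(i) + δ(i)`, where `δ` grows by 0 or 1 at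
each step because the colon contains `v`. Hence `h(i) = min (i + 1) d - δ(i)`. Both terms grow by 0
or 1, so every jump of `h` is at most 1 (`abs_sub_le_one_of_span_pair`).

Sufficiency: admissibility forces `h(i) = i + 1` for `i < d` and `h` nonincreasing from `d - 1` on.
The colon formula for `v` is then read backwards: it prescribes the Hilbert function of `(f, g)`,
which has shorter support, and induction builds the pair (`exists_span_pair`). -/

open IsLocalRing Module

/-! ### Colon exact sequences and colengths -/

section Finrank

variable {k R : Type*} [Field k] [CommRing R] [Algebra k R]

/-- The multiplication map `R ⧸ I' → R ⧸ I` by an element `v` with `v I' ⊆ I`. -/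
noncomputable def quotientMulLeft (k : Type*) {R : Type*} [Field k] [CommRing R] [Algebra k R]
    (v : R) (I' I : Ideal R) (h : ∀ p ∈ I', v * p ∈ I) : (R ⧸ I') →ₗ[k] (R ⧸ I) :=
  (Submodule.mapQ I' I (LinearMap.mulLeft R v) h).restrictScalars k

theorem quotientMulLeft_mk (v : R) (I' I : Ideal R) (h : ∀ p ∈ I', v * p ∈ I) (p : R) :
    quotientMulLeft k v I' I h (Ideal.Quotient.mk I' p) = Ideal.Quotient.mk I (v * p) := rfl

/-- The projection `R ⧸ I → R ⧸ I'` for `I ≤ I'`. -/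
noncomputable def quotientFactor (k : Type*) {R : Type*} [Field k] [CommRing R] [Algebra k R]
    (I I' : Ideal R) (h : I ≤ I') : (R ⧸ I) →ₗ[k] (R ⧸ I') :=
  (Submodule.factor h).restrictScalars k

theorem quotientFactor_mk (I I' : Ideal R) (h : I ≤ I') (p : R) :
    quotientFactor k I I' h (Ideal.Quotient.mk I p) = Ideal.Quotient.mk I' p := rfl

theorem quotientFactor_surjective (I I' : Ideal R) (h : I ≤ I') :
    Function.Surjective (quotientFactor k I I' h) := by
  intro y
  obtain ⟨p, rfl⟩ := Ideal.Quotient.mk_surjective y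
  exact ⟨Ideal.Quotient.mk I p, rfl⟩

theorem quotient_finite_of_le {I I' : Ideal R} (h : I ≤ I') [Module.Finite k (R ⧸ I)] :
    Module.Finite k (R ⧸ I') :=
  Module.Finite.of_surjective _ (quotientFactor_surjective I I' h)

theorem finrank_quotient_le_of_le {I I' : Ideal R} (h : I ≤ I') [Module.Finite k (R ⧸ I)] :
    finrank k (R ⧸ I') ≤ finrank k (R ⧸ I) :=
  LinearMap.finrank_le_finrank_of_surjective (quotientFactor_surjective I I' h)

theorem eq_of_le_of_finrank_quotient_eq {I I' : Ideal R} (h : I ≤ I') [Module.Finite k (R ⧸ I)]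
    (he : finrank k (R ⧸ I) = finrank k (R ⧸ I')) : I = I' := by
  have := quotient_finite_of_le (k := k) h
  refine le_antisymm h fun p hp => ?_
  have hinj := (LinearMap.injective_iff_surjective_of_finrank_eq_finrank he).2
    (quotientFactor_surjective (k := k) I I' h)
  rw [← Ideal.Quotient.eq_zero_iff_mem]
  apply hinj
  rw [quotientFactor_mk, map_zero]
  exact Ideal.Quotient.eq_zero_iff_mem.2 hp

/-- Exactness in the middle of the colon sequence. It needs only `v I' ⊆ I`; that `I'` is the full
colon matters for injectivity on the left. -/
theorem range_quotientMulLeft (v : R) (I' I : Ideal R) (h : ∀ p ∈ I', v * p ∈ I) :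
    LinearMap.range (quotientMulLeft k v I' I h) =
      LinearMap.ker (quotientFactor k I (I ⊔ Ideal.span {v}) le_sup_left) := by
  ext y
  obtain ⟨p, rfl⟩ := Ideal.Quotient.mk_surjective y
  rw [LinearMap.mem_ker, quotientFactor_mk, Ideal.Quotient.eq_zero_iff_mem, LinearMap.mem_range]
  constructor
  · rintro ⟨z, hz⟩
    obtain ⟨q, rfl⟩ := Ideal.Quotient.mk_surjective z
    rw [quotientMulLeft_mk, Ideal.Quotient.eq] at hz
    have : p = -(v * q - p) + v * q := by ring
    rw [this]
    exact Submodule.add_mem_sup (neg_mem hz) (Ideal.mul_mem_right _ _ (Ideal.mem_span_singleton_self v))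
  · intro hp
    obtain ⟨a, ha, b, hb, rfl⟩ := Submodule.mem_sup.1 hp
    obtain ⟨q, rfl⟩ := Ideal.mem_span_singleton.1 hb
    refine ⟨Ideal.Quotient.mk I' q, ?_⟩
    rw [quotientMulLeft_mk, Ideal.Quotient.eq]
    simpa using ha

/-- Exactness of `0 → R ⧸ (I : v) → R ⧸ I → R ⧸ (I + (v)) → 0`, on the level of finiteness. -/
theorem quotient_finite_of_colon {v : R} {I I' : Ideal R} (h : ∀ p, v * p ∈ I ↔ p ∈ I')
    [Module.Finite k (R ⧸ I')] [Module.Finite k (R ⧸ (I ⊔ Ideal.span {v}))] :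
    Module.Finite k (R ⧸ I) := by
  have h1 : Module.Finite k (LinearMap.range (quotientMulLeft k v I' I fun p => (h p).2)) :=
    inferInstance
  rw [range_quotientMulLeft] at h1
  have h2 := Module.Finite.equiv (LinearMap.quotKerEquivOfSurjective _
    (quotientFactor_surjective (k := k) I (I ⊔ Ideal.span {v}) le_sup_left)).symm
  exact Module.Finite.of_submodule_quotient
    (LinearMap.ker (quotientFactor k I (I ⊔ Ideal.span {v}) le_sup_left))

/-- Exactness of `0 → R ⧸ (I : v) → R ⧸ I → R ⧸ (I + (v)) → 0`, on the level of dimensions. -/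
theorem finrank_quotient_eq_colon_add {v : R} {I I' : Ideal R} (h : ∀ p, v * p ∈ I ↔ p ∈ I')
    [Module.Finite k (R ⧸ I)] :
    finrank k (R ⧸ I) = finrank k (R ⧸ I') + finrank k (R ⧸ (I ⊔ Ideal.span {v})) := by
  rw [← LinearMap.finrank_range_add_finrank_ker
    (quotientFactor k I (I ⊔ Ideal.span {v}) le_sup_left), ← range_quotientMulLeft v I' I
      fun p => (h p).2, LinearMap.range_eq_top.2 (quotientFactor_surjective _ _ _), finrank_top,
    LinearMap.finrank_range_of_inj, add_comm]
  rw [injective_iff_map_eq_zero]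
  intro y hy
  obtain ⟨p, rfl⟩ := Ideal.Quotient.mk_surjective y
  rw [quotientMulLeft_mk, Ideal.Quotient.eq_zero_iff_mem, h] at hy
  exact Ideal.Quotient.eq_zero_iff_mem.2 hy

/-- If multiplication by `v` induces a surjection `A / A' → B / B'`, then
`dim B / B' ≤ dim A / A'`. -/
theorem finrank_quotient_sub_le {v : R} {A' A B' B : Ideal R} (hA : A' ≤ A) (hB : B' ≤ B)
    (h' : ∀ p ∈ A', v * p ∈ B') (hs : ∀ q ∈ B, ∃ p ∈ A, q - v * p ∈ B')
    [Module.Finite k (R ⧸ A')] [Module.Finite k (R ⧸ B')] :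
    finrank k (R ⧸ B') + finrank k (R ⧸ A) ≤ finrank k (R ⧸ A') + finrank k (R ⧸ B) := by
  have key : LinearMap.ker (quotientFactor k B' B hB) ≤
      (LinearMap.ker (quotientFactor k A' A hA)).map (quotientMulLeft k v A' B' h') := by
    intro y hy
    obtain ⟨q, rfl⟩ := Ideal.Quotient.mk_surjective y
    rw [LinearMap.mem_ker, quotientFactor_mk, Ideal.Quotient.eq_zero_iff_mem] at hy
    obtain ⟨p, hp, hpq⟩ := hs q hy
    refine ⟨Ideal.Quotient.mk A' p, ?_, ?_⟩
    · rw [SetLike.mem_coe, LinearMap.mem_ker, quotientFactor_mk]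
      exact Ideal.Quotient.eq_zero_iff_mem.2 hp
    · rw [quotientMulLeft_mk, eq_comm, Ideal.Quotient.eq]
      exact hpq
  have h1 := (Submodule.finrank_mono key).trans (Submodule.finrank_map_le _ _)
  have h2 := LinearMap.finrank_range_add_finrank_ker (quotientFactor k A' A hA)
  have h3 := LinearMap.finrank_range_add_finrank_ker (quotientFactor k B' B hB)
  rw [LinearMap.range_eq_top.2 (quotientFactor_surjective _ _ _), finrank_top] at h2 h3
  omega

end Finrank

/-! ### Regular parameters and truncated colengths -/

section RegularParameters

/-- `u, v` is a regular system of parameters of the local `k`-algebra `R` of dimension two,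
with residue field `k`. -/
structure IsRegularParameterPair (k : Type*) {R : Type*} [Field k] [CommRing R] [IsLocalRing R]
    [Algebra k R] (u v : R) : Prop where
  span_eq : Ideal.span {u, v} = maximalIdeal R
  ne_zero : u ≠ 0
  dvd_of_dvd_mul : ∀ b, u ∣ v * b → u ∣ b
  finrank_residue : finrank k (R ⧸ maximalIdeal R) = 1

/-- `f` has order `d` and its leading form is not divisible by that of `v`. -/
def IsRegularOfOrder {R : Type*} [CommRing R] [IsLocalRing R] (u v : R) (d : ℕ) (f : R) : Prop :=
  f ∈ maximalIdeal R ^ d ∧ ∃ e w, IsUnit e ∧ f = v * w + e * u ^ d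

/-- The colength of `J + 𝔪 ^ i`. -/
noncomputable def truncatedColength (k : Type*) {R : Type*} [Field k] [CommRing R] [IsLocalRing R]
    [Algebra k R] (J : Ideal R) (i : ℕ) : ℕ :=
  finrank k (R ⧸ (J ⊔ maximalIdeal R ^ i))

variable {k R : Type*} [Field k] [CommRing R] [IsLocalRing R] [Algebra k R] {u v : R}

theorem truncatedColength_zero (J : Ideal R) : truncatedColength k J 0 = 0 := by
  have : Subsingleton (R ⧸ (J ⊔ maximalIdeal R ^ 0)) := by
    rw [Ideal.Quotient.subsingleton_iff]
    simp
  exact finrank_zero_of_subsingleton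

namespace IsRegularParameterPair

variable (H : IsRegularParameterPair k u v)

include H

theorem left_mem : u ∈ maximalIdeal R := H.span_eq ▸ Ideal.subset_span (by simp)

theorem right_mem : v ∈ maximalIdeal R := H.span_eq ▸ Ideal.subset_span (by simp)

theorem right_ne_zero : v ≠ 0 := by
  rintro rfl
  exact H.left_mem (isUnit_of_dvd_one (H.dvd_of_dvd_mul 1 (by simp)))


theorem pow_succ_le (n : ℕ) : maximalIdeal R ^ (n + 1) ≤
    Ideal.span {v} * maximalIdeal R ^ n ⊔ Ideal.span {u ^ (n + 1)} := by
  have hm : maximalIdeal R = Ideal.span {v} ⊔ Ideal.span {u} := by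
    rw [← H.span_eq, Ideal.span_insert, sup_comm]
  induction n with
  | zero => simp [← hm]
  | succ n ih =>
    calc maximalIdeal R ^ (n + 1 + 1)
        ≤ (Ideal.span {v} * maximalIdeal R ^ n ⊔ Ideal.span {u ^ (n + 1)}) * maximalIdeal R := by
          rw [pow_succ _ (n + 1)]
          exact Ideal.mul_mono_left ih
      _ ≤ _ := by
          rw [Ideal.sup_mul, mul_assoc, ← pow_succ]
          refine sup_le le_sup_left ?_
          conv_lhs => rw [hm, Ideal.mul_sup]
          refine sup_le ((?_ : _ ≤ _).trans le_sup_left) ((?_ : _ ≤ _).trans le_sup_right)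
          · rw [mul_comm]
            refine Ideal.mul_mono_right ?_
            rw [Ideal.span_singleton_le_iff_mem]
            exact Ideal.pow_mem_pow H.left_mem _
          · rw [Ideal.span_singleton_mul_span_singleton, ← pow_succ]

theorem exists_eq_of_mem_pow_succ {n : ℕ} {p : R} (hp : p ∈ maximalIdeal R ^ (n + 1)) :
    ∃ q ∈ maximalIdeal R ^ n, ∃ a, p = v * q + a * u ^ (n + 1) := by
  obtain ⟨s, hs, t, ht, rfl⟩ := Submodule.mem_sup.1 (H.pow_succ_le n hp)
  obtain ⟨q, hq, rfl⟩ := Ideal.mem_span_singleton_mul.1 hs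
  obtain ⟨a, rfl⟩ := Ideal.mem_span_singleton'.1 ht
  exact ⟨q, hq, a, rfl⟩

theorem exists_eq_of_mem_pow {n : ℕ} {p : R} (hp : p ∈ maximalIdeal R ^ n) :
    ∃ q a, p = v * q + a * u ^ n := by
  cases n with
  | zero => exact ⟨0, p, by simp⟩
  | succ n =>
    obtain ⟨q, -, a, h⟩ := H.exists_eq_of_mem_pow_succ hp
    exact ⟨q, a, h⟩

theorem isRegularOfOrder {d : ℕ} {f : R} (hf : f ∈ maximalIdeal R ^ d)
    (hn : f ∉ maximalIdeal R ^ (d + 1) ⊔ Ideal.span {v}) : IsRegularOfOrder u v d f := by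
  obtain ⟨w, e, rfl⟩ := H.exists_eq_of_mem_pow hf
  refine ⟨hf, e, w, ?_, rfl⟩
  by_contra he
  apply hn
  rw [sup_comm]
  refine Submodule.add_mem_sup (Ideal.mul_mem_right _ _ (Ideal.mem_span_singleton_self v)) ?_
  rw [pow_succ']
  exact Ideal.mul_mem_mul he (Ideal.pow_mem_pow H.left_mem _)

/-- Modulo `v` only powers of `u` survive: `f` becomes a unit times `u ^ d` and `𝔪 ^ n` becomes `(u
^ n)`. The bound on `J` ensures that nothing but `f` contributes. -/
theorem sup_eq_of_isRegularOfOrder {d n : ℕ} {f : R} (hf : IsRegularOfOrder u v d f)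
    {J : Ideal R} (hJ : f ∈ J) (hJd : J ≤ Ideal.span {f} ⊔ Ideal.span {v}) :
    J ⊔ maximalIdeal R ^ n ⊔ Ideal.span {v} = Ideal.span {u ^ min n d} ⊔ Ideal.span {v} := by
  obtain ⟨-, e, w, he, hfe⟩ := hf
  obtain ⟨e, rfl⟩ := he
  have hv : v ∈ Ideal.span {u ^ min n d} ⊔ Ideal.span {v} :=
    Ideal.mem_sup_right (Ideal.mem_span_singleton_self v)
  have hu : u ^ min n d ∈ Ideal.span {u ^ min n d} ⊔ Ideal.span {v} :=
    Ideal.mem_sup_left (Ideal.mem_span_singleton_self _)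
  have hu' : ∀ m, min n d ≤ m → u ^ m ∈ Ideal.span {u ^ min n d} ⊔ Ideal.span {v} := by
    intro m hm
    obtain ⟨l, rfl⟩ := Nat.exists_eq_add_of_le hm
    rw [pow_add]
    exact Ideal.mul_mem_right _ _ hu
  refine le_antisymm (sup_le (sup_le (hJd.trans (sup_le ?_ le_sup_right)) ?_) le_sup_right)
    (sup_le ?_ le_sup_right)
  · rw [Ideal.span_singleton_le_iff_mem, hfe]
    exact add_mem (Ideal.mul_mem_right _ _ hv) (Ideal.mul_mem_left _ _ (hu' _ (min_le_right _ _)))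
  · intro p hp
    obtain ⟨q, a, rfl⟩ := H.exists_eq_of_mem_pow hp
    exact add_mem (Ideal.mul_mem_right _ _ hv) (Ideal.mul_mem_left _ _ (hu' _ (min_le_left _ _)))
  · rw [Ideal.span_singleton_le_iff_mem]
    rcases min_choice n d with h | h <;> rw [h]
    · exact Ideal.mem_sup_left (Ideal.mem_sup_right (Ideal.pow_mem_pow H.left_mem _))
    · have : u ^ d = ↑e⁻¹ * f + v * (- ↑e⁻¹ * w) := by
        rw [hfe]
        linear_combination (-(u ^ d)) * e.inv_mul
      rw [this]
      exact add_mem (Ideal.mem_sup_left (Ideal.mem_sup_left (Ideal.mul_mem_left _ _ hJ)))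
        (Ideal.mem_sup_right (Ideal.mul_mem_right _ _ (Ideal.mem_span_singleton_self v)))

/-- By regularity the colon of `(u ^ (n + 1), v)` by `u` is `(u ^ n, v)`, so each step adds one copy
of the residue field. -/
theorem finite_and_finrank_span_pow [IsDomain R] (n : ℕ) :
    Module.Finite k (R ⧸ (Ideal.span {u ^ n} ⊔ Ideal.span {v})) ∧
      finrank k (R ⧸ (Ideal.span {u ^ n} ⊔ Ideal.span {v})) = n := by
  induction n with
  | zero =>
    have : Subsingleton (R ⧸ (Ideal.span {u ^ 0} ⊔ Ideal.span {v})) := by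
      rw [Ideal.Quotient.subsingleton_iff]
      simp
    exact ⟨inferInstance, finrank_zero_of_subsingleton⟩
  | succ n ih =>
    obtain ⟨ih1, ih2⟩ := ih
    have h : ∀ p, u * p ∈ Ideal.span {u ^ (n + 1)} ⊔ Ideal.span {v} ↔
        p ∈ Ideal.span {u ^ n} ⊔ Ideal.span {v} := by
      intro p
      rw [← Ideal.span_insert, ← Ideal.span_insert, Ideal.mem_span_pair, Ideal.mem_span_pair]
      constructor
      · rintro ⟨a, b, hab⟩
        obtain ⟨c, hc⟩ := H.dvd_of_dvd_mul b ⟨p - a * u ^ n, by linear_combination hab⟩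
        refine ⟨a, c, mul_left_cancel₀ H.ne_zero ?_⟩
        rw [← hab, hc]
        ring
      · rintro ⟨a, b, rfl⟩
        exact ⟨a, b * u, by ring⟩
    have hm : Ideal.span {u ^ (n + 1)} ⊔ Ideal.span {v} ⊔ Ideal.span {u} = maximalIdeal R := by
      rw [← H.span_eq, Ideal.span_insert, sup_assoc, sup_comm (Ideal.span {v}), ← sup_assoc]
      congr 1
      rw [sup_eq_right, Ideal.span_singleton_le_span_singleton]
      exact Dvd.intro_left _ (pow_succ u n).symm
    have h1 : finrank k (R ⧸ (Ideal.span {u ^ (n + 1)} ⊔ Ideal.span {v} ⊔ Ideal.span {u})) = 1 := by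
      rw [hm, H.finrank_residue]
    have : Module.Finite k (R ⧸ (Ideal.span {u ^ (n + 1)} ⊔ Ideal.span {v} ⊔ Ideal.span {u})) :=
      Module.finite_of_finrank_pos (by omega)
    have hfin := quotient_finite_of_colon (k := k) h
    refine ⟨hfin, ?_⟩
    rw [finrank_quotient_eq_colon_add h, ih2, h1]

theorem dvd_of_dvd_mul_pow [IsDomain R] (n : ℕ) {a : R} (h : v ∣ a * u ^ n) : v ∣ a := by
  induction n with
  | zero => simpa using h
  | succ n ih =>
    obtain ⟨b, hb⟩ := h
    obtain ⟨c, hc⟩ := H.dvd_of_dvd_mul b ⟨a * u ^ n, by rw [← hb]; ring⟩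
    refine ih ⟨c, mul_left_cancel₀ H.ne_zero ?_⟩
    linear_combination hb + v * hc

/-- The leading form of `v` is a nonzerodivisor in the associated graded ring: if `v` divides `a * u
^ (n + 1)` then it divides `a`, and `v` cancels. -/
theorem mul_mem_pow_succ_iff [IsDomain R] {n : ℕ} {p : R} :
    v * p ∈ maximalIdeal R ^ (n + 1) ↔ p ∈ maximalIdeal R ^ n := by
  constructor
  · intro h
    obtain ⟨q, hq, a, hqa⟩ := H.exists_eq_of_mem_pow_succ h
    obtain ⟨b, rfl⟩ := H.dvd_of_dvd_mul_pow (a := a) (n + 1) ⟨p - q, by linear_combination -hqa⟩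
    have : p = q + b * u * u ^ n := by
      apply mul_left_cancel₀ H.right_ne_zero
      rw [hqa]
      ring
    rw [this]
    exact add_mem hq (Ideal.mul_mem_left _ _ (Ideal.pow_mem_pow H.left_mem _))
  · intro h
    rw [pow_succ']
    exact Ideal.mul_mem_mul H.right_mem h

theorem finite_quotient_pow [IsDomain R] (n : ℕ) : Module.Finite k (R ⧸ maximalIdeal R ^ n) := by
  induction n with
  | zero =>
    have : Subsingleton (R ⧸ maximalIdeal R ^ 0) := by
      rw [Ideal.Quotient.subsingleton_iff]
      simp
    infer_instance
  | succ n ih =>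
    have h0 : IsRegularOfOrder u v (n + 1) (u ^ (n + 1)) :=
      ⟨Ideal.pow_mem_pow H.left_mem _, 1, 0, isUnit_one, by ring⟩
    have h1 := H.sup_eq_of_isRegularOfOrder (n := n + 1) h0
      (Ideal.mem_span_singleton_self _) le_sup_left
    rw [sup_eq_right.2 ((Ideal.span_singleton_le_iff_mem _).2 h0.1)] at h1
    have := (H.finite_and_finrank_span_pow (min (n + 1) (n + 1))).1
    rw [← h1] at this
    exact quotient_finite_of_colon (v := v) fun p => H.mul_mem_pow_succ_iff

theorem finite_quotient_sup_pow [IsDomain R] (J : Ideal R) (n : ℕ) :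
    Module.Finite k (R ⧸ (J ⊔ maximalIdeal R ^ n)) :=
  have := H.finite_quotient_pow n
  quotient_finite_of_le (I := maximalIdeal R ^ n) le_sup_right

theorem finrank_quotient_pow_succ [IsDomain R] (n : ℕ) :
    finrank k (R ⧸ maximalIdeal R ^ (n + 1)) = finrank k (R ⧸ maximalIdeal R ^ n) + (n + 1) := by
  have := H.finite_quotient_pow (n + 1)
  rw [finrank_quotient_eq_colon_add (v := v) fun p => H.mul_mem_pow_succ_iff]
  have h0 : IsRegularOfOrder u v (n + 1) (u ^ (n + 1)) :=
    ⟨Ideal.pow_mem_pow H.left_mem _, 1, 0, isUnit_one, by ring⟩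
  have h1 := H.sup_eq_of_isRegularOfOrder (n := n + 1) h0
    (Ideal.mem_span_singleton_self _) le_sup_left
  rw [sup_eq_right.2 ((Ideal.span_singleton_le_iff_mem _).2 h0.1)] at h1
  rw [h1, (H.finite_and_finrank_span_pow _).2, min_self]

/-- The colon ideal of `(f, v g) + 𝔪 ^ (i + 1)` by `v`. -/
theorem mul_mem_span_pair_sup_pow_iff [IsDomain R] {d i : ℕ} {f g : R}
    (hf : IsRegularOfOrder u v d f) (p : R) :
    v * p ∈ Ideal.span {f, v * g} ⊔ maximalIdeal R ^ (i + 1) ↔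
      p ∈ Ideal.span {f, g} ⊔ maximalIdeal R ^ i := by
  obtain ⟨hfd, e, w, ⟨e, rfl⟩, hfe⟩ := hf
  simp only [Submodule.mem_sup, Ideal.mem_span_pair]
  constructor
  · rintro ⟨_, ⟨a, b, rfl⟩, r, hr, h⟩
    rcases le_or_gt d (i + 1) with hd | hd
    · obtain ⟨q, -, t, hqt⟩ := H.exists_eq_of_mem_pow_succ hr
      obtain ⟨l, hl⟩ := Nat.exists_eq_add_of_le hd
      -- Reducing the relation modulo `v` leaves `(a e + t u ^ l) u ^ d`. Hence `a e + t u ^ l = v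
      -- c`, and the coefficient of `f` after division by `v` is `c e⁻¹`, up to terms of high order.
      obtain ⟨c, hc⟩ := H.dvd_of_dvd_mul_pow (a := a * e + t * u ^ l) d
        ⟨p - a * w - b * g - q, by
          rw [hl, pow_add] at hqt
          linear_combination h - a * hfe - hqt⟩
      refine ⟨_, ⟨c * ↑e⁻¹, b, rfl⟩, p - (c * ↑e⁻¹ * f + b * g), ?_, by ring⟩
      rw [← H.mul_mem_pow_succ_iff]
      have : v * (p - (c * ↑e⁻¹ * f + b * g)) = r - (t * ↑e⁻¹) * (u ^ l * f) := by
        linear_combination -h + (f * ↑e⁻¹) * hc - a * f * e.mul_inv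
      rw [this]
      refine sub_mem hr (Ideal.mul_mem_left _ _ ?_)
      rw [hl, add_comm, pow_add]
      exact Ideal.mul_mem_mul (Ideal.pow_mem_pow H.left_mem _) hfd
    -- Here `f` already lies in `𝔪 ^ (i + 1)`, so its multiple is absorbed in the remainder.
    · refine ⟨_, ⟨0, b, rfl⟩, p - b * g, ?_, by ring⟩
      rw [← H.mul_mem_pow_succ_iff]
      have : v * (p - b * g) = r + a * f := by linear_combination -h
      rw [this]
      exact add_mem hr (Ideal.mul_mem_left _ _ (Ideal.pow_le_pow_right hd.le hfd))
  · rintro ⟨_, ⟨a, b, rfl⟩, r, hr, rfl⟩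
    exact ⟨_, ⟨v * a, b, rfl⟩, v * r, H.mul_mem_pow_succ_iff.2 hr, by ring⟩

theorem truncatedColength_span_pair [IsDomain R] {d : ℕ} {f : R} (hf : IsRegularOfOrder u v d f)
    (g : R) (i : ℕ) : truncatedColength k (Ideal.span {f, v * g}) (i + 1) =
      truncatedColength k (Ideal.span {f, g}) i + min (i + 1) d := by
  have := H.finite_quotient_sup_pow (Ideal.span {f, v * g}) (i + 1)
  rw [truncatedColength, finrank_quotient_eq_colon_add (H.mul_mem_span_pair_sup_pow_iff hf),
    H.sup_eq_of_isRegularOfOrder hf (Ideal.subset_span (by simp)),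
    (H.finite_and_finrank_span_pow _).2, truncatedColength]
  rw [Ideal.span_insert]
  refine sup_le_sup_left ?_ _
  rw [Ideal.span_singleton_le_span_singleton]
  exact Dvd.intro _ rfl

/-- `δ i` is the colength of the colon of `(f, v g) + 𝔪 ^ i` by `g`. For `i + 1` the colon contains
`v`, so its quotient is generated by powers of `u` and can grow by at most one dimension. -/
theorem exists_truncatedColength_eq_add [IsDomain R] (f g : R) :
    ∃ δ : ℕ → ℕ, ∀ i, δ i ≤ δ (i + 1) ∧ δ (i + 1) ≤ δ i + 1 ∧
      truncatedColength k (Ideal.span {f, v * g}) i =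
        δ i + truncatedColength k (Ideal.span {f, g}) i := by
  set J := Ideal.span {f, v * g} with hJ
  let C : ℕ → Ideal R := fun i => Submodule.comap (LinearMap.mulLeft R g) (J ⊔ maximalIdeal R ^ i)
  have hC : ∀ i p, g * p ∈ J ⊔ maximalIdeal R ^ i ↔ p ∈ C i := fun i p => Iff.rfl
  have hfinC : ∀ i, Module.Finite k (R ⧸ C i) := fun i => by
    have := H.finite_quotient_sup_pow J i
    exact quotient_finite_of_le (I := J ⊔ maximalIdeal R ^ i)
      fun p hp => (hC i p).1 (Ideal.mul_mem_left _ _ hp)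
  refine ⟨fun i => finrank k (R ⧸ C i), fun i => ⟨?_, ?_, ?_⟩⟩
  · refine finrank_quotient_le_of_le fun p hp => ?_
    exact sup_le_sup_left (Ideal.pow_le_pow_right (Nat.le_succ i)) J hp
  · have hv : v ∈ C (i + 1) := by
      rw [← hC]
      refine Ideal.mem_sup_left (Ideal.subset_span ?_)
      simp [mul_comm]
    -- Multiplication by `u` raises the order, so `C i ≤ D`; the cokernel is killed by `u` and `v`,
    -- hence has dimension at most one.
    let D : Ideal R := Submodule.comap (LinearMap.mulLeft R u) (C (i + 1))
    have hD : ∀ p, u * p ∈ C (i + 1) ↔ p ∈ D := fun p => Iff.rfl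
    change finrank k (R ⧸ C (i + 1)) ≤ finrank k (R ⧸ C i) + 1
    rw [finrank_quotient_eq_colon_add hD]
    refine add_le_add (finrank_quotient_le_of_le fun p hp => ?_) ?_
    · change g * (u * p) ∈ J ⊔ maximalIdeal R ^ (i + 1)
      obtain ⟨s, hs, t, ht, hst⟩ := Submodule.mem_sup.1 ((hC i p).2 hp)
      have : g * (u * p) = u * s + u * t := by linear_combination -u * hst
      rw [this]
      refine Submodule.add_mem_sup (Ideal.mul_mem_left _ _ hs) ?_
      rw [pow_succ']
      exact Ideal.mul_mem_mul H.left_mem ht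
    · have := Module.finite_of_finrank_pos (R := k) (M := R ⧸ maximalIdeal R)
        (by rw [H.finrank_residue]; exact one_pos)
      refine le_of_le_of_eq (finrank_quotient_le_of_le ?_) H.finrank_residue
      rw [← H.span_eq, Ideal.span_insert, sup_comm]
      exact sup_le_sup_right ((Ideal.span_singleton_le_iff_mem _).2 hv) _
  · have := H.finite_quotient_sup_pow J i
    have hg : Ideal.span {v * g} ⊔ Ideal.span {g} = Ideal.span {g} := by
      rw [sup_eq_right, Ideal.span_singleton_le_span_singleton]
      exact Dvd.intro_left _ rfl
    have he : J ⊔ maximalIdeal R ^ i ⊔ Ideal.span {g} =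
        Ideal.span {f, g} ⊔ maximalIdeal R ^ i := by
      rw [sup_right_comm, hJ, Ideal.span_insert, sup_assoc (Ideal.span {f}), Ideal.span_insert, hg]
    rw [truncatedColength, finrank_quotient_eq_colon_add (hC i), he, truncatedColength]

theorem truncatedColength_succ_of_le_pow [IsDomain R] {d i : ℕ} {J : Ideal R}
    (hJ : J ≤ maximalIdeal R ^ d) (hi : i < d) :
    truncatedColength k J (i + 1) = truncatedColength k J i + (i + 1) := by
  rw [truncatedColength, truncatedColength,
    sup_eq_right.2 (hJ.trans (Ideal.pow_le_pow_right hi)),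
    sup_eq_right.2 (hJ.trans (Ideal.pow_le_pow_right hi.le)), H.finrank_quotient_pow_succ]

/-- Since `d ≤ i + 1`, `f` makes `u ^ (i + 1)` a multiple of `v` modulo `J`. Multiplication by `v`
therefore maps the `i`-th graded piece of `R / J` onto the next one. -/
theorem truncatedColength_concave [IsDomain R] {d i : ℕ} {J : Ideal R} {f : R}
    (hf : IsRegularOfOrder u v d f) (hJ : f ∈ J) (hi : d ≤ i + 1) :
    truncatedColength k J (i + 2) + truncatedColength k J i ≤
      truncatedColength k J (i + 1) + truncatedColength k J (i + 1) := by
  have := H.finite_quotient_sup_pow J (i + 1)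
  have := H.finite_quotient_sup_pow J (i + 2)
  refine finrank_quotient_sub_le (v := v)
    (sup_le_sup_left (Ideal.pow_le_pow_right (Nat.le_succ i)) J)
    (sup_le_sup_left (Ideal.pow_le_pow_right (Nat.le_succ (i + 1))) J) ?_ ?_
  · intro p hp
    obtain ⟨s, hs, t, ht, rfl⟩ := Submodule.mem_sup.1 hp
    rw [mul_add]
    exact Submodule.add_mem_sup (Ideal.mul_mem_left _ _ hs) (H.mul_mem_pow_succ_iff.2 ht)
  · intro q hq
    obtain ⟨s, hs, t, ht, rfl⟩ := Submodule.mem_sup.1 hq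
    obtain ⟨hfd, _, w, ⟨e, rfl⟩, hfe⟩ := hf
    obtain ⟨r, hr, a, rfl⟩ := H.exists_eq_of_mem_pow_succ ht
    obtain ⟨l, hl⟩ := Nat.exists_eq_add_of_le hi
    have hw : u ^ l * w ∈ maximalIdeal R ^ i := by
      rw [← H.mul_mem_pow_succ_iff]
      have : v * (u ^ l * w) = u ^ l * f - e * u ^ (i + 1) := by
        rw [hfe, hl, pow_add]; ring
      rw [this]
      refine sub_mem ?_ (Ideal.mul_mem_left _ _ (Ideal.pow_mem_pow H.left_mem _))
      rw [hl, add_comm, pow_add]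
      exact Ideal.mul_mem_mul (Ideal.pow_mem_pow H.left_mem _) hfd
    refine ⟨r - a * ↑e⁻¹ * (u ^ l * w), Ideal.mem_sup_right
      (sub_mem hr (Ideal.mul_mem_left _ _ hw)), Ideal.mem_sup_left ?_⟩
    have : s + (v * r + a * u ^ (i + 1)) - v * (r - a * ↑e⁻¹ * (u ^ l * w)) =
        s + a * ↑e⁻¹ * u ^ l * f := by
      rw [hfe, hl, pow_add]
      linear_combination (-(a * u ^ d * u ^ l)) * e.inv_mul
    rw [this]
    exact add_mem hs (Ideal.mul_mem_left _ _ hJ)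

end IsRegularParameterPair

/-- A power series is regular with respect to almost all linear forms. -/
theorem finite_setOf_mem_sup_span [IsDomain R] {x y : R}
    (H : ∀ c : k, IsRegularParameterPair k x (y - algebraMap k R c * x)) {d : ℕ} {f : R}
    (hf : f ∈ maximalIdeal R ^ d) (hf' : f ∉ maximalIdeal R ^ (d + 1)) :
    {c : k | f ∈ maximalIdeal R ^ (d + 1) ⊔
      Ideal.span {y - algebraMap k R c * x}}.Finite := by
  induction d generalizing f with
  | zero =>
    convert Set.finite_empty
    refine Set.eq_empty_iff_forall_notMem.2 fun c hc => hf' ?_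
    refine (sup_le le_rfl ?_ : _ ≤ maximalIdeal R ^ (0 + 1)) hc
    rw [Ideal.span_singleton_le_iff_mem, zero_add, pow_one]
    exact (H c).right_mem
  | succ d ih =>
    rcases Set.eq_empty_or_nonempty {c : k | f ∈ maximalIdeal R ^ (d + 1 + 1) ⊔
      Ideal.span {y - algebraMap k R c * x}} with h | ⟨c₀, hc₀⟩
    · rw [h]
      exact Set.finite_empty
    obtain ⟨r, hr, s, hs, hrs⟩ := Submodule.mem_sup.1 hc₀
    obtain ⟨w, rfl⟩ := Ideal.mem_span_singleton.1 hs
    -- The leading form of `f` is divided by the line of slope `c₀`; the quotient `w` has order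
    -- exactly `d`, and any other line dividing the former must divide the latter.
    have hw : w ∈ maximalIdeal R ^ d := by
      rw [← (H c₀).mul_mem_pow_succ_iff]
      rw [← eq_sub_iff_add_eq'] at hrs
      rw [hrs]
      exact sub_mem hf (Ideal.pow_le_pow_right (Nat.le_succ _) hr)
    have hw' : w ∉ maximalIdeal R ^ (d + 1) := by
      rw [← (H c₀).mul_mem_pow_succ_iff]
      intro h
      exact hf' (hrs ▸ add_mem hr h)
    refine ((ih hw hw').insert c₀).subset fun c hc => ?_
    rw [Set.mem_insert_iff, or_iff_not_imp_left]
    intro hne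
    obtain ⟨r', hr', s', hs', hrs'⟩ := Submodule.mem_sup.1 hc
    obtain ⟨w', rfl⟩ := Ideal.mem_span_singleton.1 hs'
    obtain ⟨q, hq, a, hqa⟩ := (H c).exists_eq_of_mem_pow_succ (sub_mem hr' hr)
    have hcc : algebraMap k R (c - c₀)⁻¹ * (algebraMap k R c - algebraMap k R c₀) = 1 := by
      rw [← map_sub, ← map_mul, inv_mul_cancel₀ (sub_ne_zero.2 hne), map_one]
    set t := algebraMap k R (c - c₀)⁻¹
    set v := y - algebraMap k R c * x with hv
    -- The two linear forms differ by `(c - c₀) x`, with `c - c₀` invertible. Comparing the two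
    -- expressions for `f` makes `x w` a multiple of `v` up to `x ^ (d + 2)`, and `x` cancels.
    have key : x * (w - t * a * x ^ (d + 1)) = v * (t * (q + w' - w)) := by
      linear_combination (-(x * w)) * hcc + t * (hrs - hrs' + hqa) + t * w * hv
    obtain ⟨b, hb⟩ := (H c).dvd_of_dvd_mul _ (Dvd.intro _ key)
    have : w = t * a * x ^ (d + 1) + v * b := by
      apply mul_left_cancel₀ (H c).ne_zero
      linear_combination key + v * hb
    rw [Set.mem_ofPred_eq, this]
    exact Submodule.add_mem_sup
      (Ideal.mul_mem_left _ _ (Ideal.pow_mem_pow (H c).left_mem _))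
      (Ideal.mul_mem_right _ _ (Ideal.mem_span_singleton_self v))

end RegularParameters

/-! ### Ideals with two generators: bounding and realizing jumps -/

section HilbertFunction

variable {k R : Type*} [Field k] [CommRing R] [IsLocalRing R] [Algebra k R] {u v : R}

/-- Equal colengths give `𝔪 ^ N ≤ J + 𝔪 ^ (N + 1)`, and Nakayama's lemma applies. -/
theorem pow_le_of_truncatedColength_eq {J : Ideal R} {N : ℕ} (hm : (maximalIdeal R).FG)
    (hfin : Module.Finite k (R ⧸ (J ⊔ maximalIdeal R ^ (N + 1))))
    (h : truncatedColength k J (N + 1) = truncatedColength k J N) : maximalIdeal R ^ N ≤ J := by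
  have h1 := eq_of_le_of_finrank_quotient_eq (k := k)
    (sup_le_sup_left (Ideal.pow_le_pow_right (Nat.le_succ N)) J) h
  refine Submodule.le_of_le_smul_of_le_jacobson_bot (I := maximalIdeal R) (hm.pow)
    (maximalIdeal_le_jacobson _) ?_
  rw [smul_eq_mul, ← pow_succ']
  exact h1 ▸ le_sup_right

theorem truncatedColength_eq_of_le {J : Ideal R} {N i : ℕ} (hN : maximalIdeal R ^ N ≤ J)
    (hi : N ≤ i) : truncatedColength k J (i + 1) = truncatedColength k J i := by
  rw [truncatedColength, truncatedColength, sup_eq_left.2 ((Ideal.pow_le_pow_right hi).trans hN),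
    sup_eq_left.2 ((Ideal.pow_le_pow_right (hi.trans (Nat.le_succ i))).trans hN)]

variable [IsDomain R]

namespace IsRegularParameterPair

variable (H : IsRegularParameterPair k u v)

include H

/-- The first differences of the Hilbert function of an ideal with two generators are bounded
by `1`. -/
theorem abs_sub_le_one_of_span_pair {d : ℕ} {f b : R} (hf : IsRegularOfOrder u v d f)
    (hb : b ∈ maximalIdeal R ^ d) {h : ℕ → ℕ}
    (hh : ∀ i, h i + truncatedColength k (Ideal.span {f, b}) i =
      truncatedColength k (Ideal.span {f, b}) (i + 1)) (i : ℕ) :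
    ((h (i + 1) : ℤ) - (h i : ℤ)).natAbs ≤ 1 := by
  obtain ⟨q, t, hqt⟩ := H.exists_eq_of_mem_pow hb
  obtain ⟨-, _, w, ⟨e, rfl⟩, hfe⟩ := id hf
  -- Subtracting `t e⁻¹ f` kills the term `t u ^ d` of `b`, so the second generator becomes
  -- divisible by `v`.
  have hbg : b + f * (-(t * ↑e⁻¹)) = v * (q - t * ↑e⁻¹ * w) := by
    rw [hfe, hqt]
    linear_combination (-(t * u ^ d)) * e.inv_mul
  have hspan : Ideal.span {f, b} = Ideal.span {f, v * (q - t * ↑e⁻¹ * w)} := by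
    rw [← hbg, mul_comm f, Ideal.span_pair_add_mul_left]
  rw [hspan] at hh
  obtain ⟨δ, hδ⟩ := H.exists_truncatedColength_eq_add f (q - t * ↑e⁻¹ * w)
  have h1 := H.truncatedColength_span_pair hf (q - t * ↑e⁻¹ * w) i
  have h2 := H.truncatedColength_span_pair hf (q - t * ↑e⁻¹ * w) (i + 1)
  have h3 := hh i
  have h4 := hh (i + 1)
  have h5 := hδ i
  have h6 := hδ (i + 1)
  omega

/-- A principal ideal generated by an element of positive order has infinite colength. -/
theorem truncatedColength_span_singleton_lt {d : ℕ} (hd : d ≠ 0) {f : R}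
    (hf : IsRegularOfOrder u v d f) (i : ℕ) :
    truncatedColength k (Ideal.span {f}) i < truncatedColength k (Ideal.span {f}) (i + 1) := by
  have h := H.truncatedColength_span_pair hf 0 i
  have h0 : Ideal.span {f, (0 : R)} = Ideal.span {f} := by
    rw [Ideal.span_insert, Ideal.span_singleton_eq_bot.2 rfl, sup_bot_eq]
  rw [mul_zero, h0] at h
  omega

theorem pow_not_le_pow_succ (n : ℕ) : ¬ maximalIdeal R ^ n ≤ maximalIdeal R ^ (n + 1) := by
  intro h
  have h1 := H.finrank_quotient_pow_succ n
  rw [le_antisymm (Ideal.pow_le_pow_right (Nat.le_succ n)) h] at h1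
  omega

theorem exists_order {J : Ideal R} {N : ℕ} (hN : maximalIdeal R ^ N ≤ J) :
    ∃ d, J ≤ maximalIdeal R ^ d ∧ ¬ J ≤ maximalIdeal R ^ (d + 1) := by
  classical
  have hex : ∃ n, ¬ J ≤ maximalIdeal R ^ n :=
    ⟨N + 1, fun h => H.pow_not_le_pow_succ N (hN.trans h)⟩
  obtain ⟨d, hd⟩ : ∃ d, Nat.find hex = d + 1 := by
    refine Nat.exists_eq_succ_of_ne_zero fun h => ?_
    have := Nat.find_spec hex
    rw [h] at this
    simp at this
  refine ⟨d, ?_, hd ▸ Nat.find_spec hex⟩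
  by_contra hn
  have := Nat.find_min' hex hn
  omega

/-- Hilbert functions with jumps bounded by `1` are realized by ideals with two generators. -/
theorem exists_span_pair (N : ℕ) : ∀ (h : ℕ → ℕ) (d : ℕ), (∀ i < d, h i = i + 1) → h d ≤ d →
    d ≤ h d + 1 → (∀ i, d ≤ i → h (i + 1) ≤ h i ∧ h i ≤ h (i + 1) + 1) → (∀ i, N ≤ i → h i = 0) →
    ∃ f g, IsRegularOfOrder u v d f ∧ g ∈ maximalIdeal R ^ (d - 1) ∧
      (h d = d → g ∈ maximalIdeal R ^ d) ∧
      ∀ i, truncatedColength k (Ideal.span {f, v * g}) i = ∑ j ∈ Finset.range i, h j := by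
  induction N with
  | zero =>
    intro h d h1 h2 h3 h4 h5
    obtain rfl : d = 0 := by
      by_contra hd
      have := h1 0 (by omega)
      have := h5 0 le_rfl
      omega
    -- The zero function belongs to the unit ideal; the induction therefore allows `d = 0`.
    refine ⟨1, 0, ⟨by simp, 1, 0, isUnit_one, by simp⟩, zero_mem _, fun _ => zero_mem _,
      fun i => ?_⟩
    have : Subsingleton (R ⧸ (Ideal.span {1, v * 0} ⊔ maximalIdeal R ^ i)) := by
      rw [Ideal.Quotient.subsingleton_iff, Ideal.span_insert]
      simp
    rw [truncatedColength, finrank_zero_of_subsingleton, Finset.sum_eq_zero]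
    exact fun j _ => h5 j (Nat.zero_le j)
  | succ N ih =>
    intro h d h1 h2 h3 h4 h5
    rcases d with _ | d
    · have hz : ∀ i, h i = 0 := by
        intro i
        induction i with
        | zero => omega
        | succ i ihi => exact Nat.le_zero.1 (ihi ▸ (h4 i (Nat.zero_le i)).1)
      exact ih h 0 h1 h2 h3 h4 fun i _ => hz i
    have hdN : d ≤ N := by
      by_contra hdN
      have := h1 d (by omega)
      have := h5 d (by omega)
      omega
    -- The Hilbert function that `truncatedColength_span_pair` forces on the colon ideal `(f, g)`
    -- when `f` has order `d + 1`.
    set h'' : ℕ → ℕ := fun i => h (i + 1) - if i + 1 < d + 1 then 1 else 0 with hh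
    have ha : ∀ i, i < d → h'' i = i + 1 := by
      intro i hi
      have := h1 (i + 1) (by omega)
      simp only [hh]
      rw [if_pos (by omega)]
      omega
    have hb : ∀ i, d ≤ i → h'' i = h (i + 1) := by
      intro i hi
      simp only [hh]
      rw [if_neg (by omega)]
      omega
    have hsum : ∀ i, ∑ j ∈ Finset.range (i + 1), h j =
        ∑ j ∈ Finset.range i, h'' j + min (i + 1) (d + 1) := by
      intro i
      induction i with
      | zero => simp [h1 0]
      | succ i ihi =>
        rw [Finset.sum_range_succ, ihi, Finset.sum_range_succ _ i]
        rcases lt_or_ge i d with hi | hi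
        · have := ha i hi
          have := h1 (i + 1) (by omega)
          omega
        · have := hb i hi
          omega
    have hd4 := h4 (d + 1) le_rfl
    -- This decides the order prescribed by `h''`: `d + 1` on equality, when the same `f` serves
    -- again, and `d` otherwise, when a new generator of order `d + 1` must be made.
    by_cases hcase : h (d + 1) = d + 1
    · obtain ⟨f, g, hf, hg, -, hL⟩ := ih h'' (d + 1)
        (fun i hi => by
          rcases Nat.lt_succ_iff_lt_or_eq.1 hi with hi | rfl
          · exact ha i hi
          · rw [hb i le_rfl, hcase])
        (by rw [hb _ (by omega)]; omega) (by rw [hb _ (by omega)]; omega)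
        (fun i hi => by
          rw [hb _ (by omega), hb _ (by omega)]
          exact h4 _ (by omega))
        (fun i hi => by rw [hb _ (by omega)]; exact h5 _ (by omega))
      have hvg : v * g ∈ maximalIdeal R ^ (d + 1) := H.mul_mem_pow_succ_iff.2 hg
      refine ⟨f, v * g, hf, Ideal.pow_le_pow_right (by omega) hvg, fun _ => hvg, fun i => ?_⟩
      cases i with
      | zero => simp [truncatedColength_zero]
      | succ i => rw [H.truncatedColength_span_pair hf, hL, hsum]
    · obtain ⟨f, g, hf, -, hg, hL⟩ := ih h'' d ha
        (by rw [hb _ le_rfl]; omega) (by rw [hb _ le_rfl]; omega)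
        (fun i hi => by
          rw [hb _ (by omega), hb _ (by omega)]
          exact h4 _ (by omega))
        (fun i hi => by rw [hb _ (by omega)]; exact h5 _ (by omega))
      have hg := hg (by rw [hb _ le_rfl]; omega)
      obtain ⟨hfd, e, w, he, hfe⟩ := hf
      -- The new pair is `(F, v f)` with `F = v g + u f`; its colon partner `(F, f)` equals `(f, v
      -- g)`, the ideal given by induction. The condition `g ∈ 𝔪 ^ d`, carried through the
      -- induction, gives `F` order `d + 1`.
      have hF : IsRegularOfOrder u v (d + 1) (v * g + f * u) := by
        refine ⟨add_mem (H.mul_mem_pow_succ_iff.2 hg) ?_, e, g + u * w, he, ?_⟩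
        · rw [pow_succ]
          exact Ideal.mul_mem_mul hfd H.left_mem
        · rw [hfe]
          ring
      refine ⟨v * g + f * u, f, hF, hfd, fun h' => absurd h' hcase, fun i => ?_⟩
      cases i with
      | zero => simp [truncatedColength_zero]
      | succ i =>
        rw [H.truncatedColength_span_pair hF, Set.pair_comm, mul_comm f u,
          Ideal.span_pair_add_mul_left, hL, hsum]

end IsRegularParameterPair

end HilbertFunction

/-- Finite support makes the jumps bounded, so the supremum is not the default value 0. It cannot be
0 either, since `h` would then be constantly 1. -/
theorem maxJump_eq_one_iff {h : ℕ → ℕ} {N : ℕ} (h0 : h 0 = 1) (hN : ∀ i, N ≤ i → h i = 0) :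
    maxJump h = 1 ↔ ∀ i, ((h (i + 1) : ℤ) - (h i : ℤ)).natAbs ≤ 1 := by
  have hbdd : BddAbove (Set.range fun i => ((h (i + 1) : ℤ) - (h i : ℤ)).natAbs) := by
    refine ⟨∑ j ∈ Finset.range N, ((h (j + 1) : ℤ) - (h j : ℤ)).natAbs, ?_⟩
    rintro _ ⟨i, rfl⟩
    rcases lt_or_ge i N with hi | hi
    · exact Finset.single_le_sum (f := fun j => ((h (j + 1) : ℤ) - (h j : ℤ)).natAbs)
        (fun _ _ => Nat.zero_le _) (Finset.mem_range.2 hi)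
    · simp [hN i hi, hN (i + 1) (by omega)]
  refine ⟨fun hm i => (le_ciSup hbdd i).trans_eq hm, fun hi => le_antisymm (ciSup_le hi) ?_⟩
  by_contra hlt
  have hconst : ∀ i, h i = 1 := by
    intro i
    induction i with
    | zero => exact h0
    | succ i ih =>
      have : ((h (i + 1) : ℤ) - (h i : ℤ)).natAbs ≤ maxJump h := le_ciSup hbdd i
      omega
  have := hconst N
  rw [hN N le_rfl] at this
  omega

/-! ### Regular parameters in `k[[x, y]]` -/

section PowerSeries

variable {k : Type*} [Field k]

/-- The quotient of `R / J` by `𝔫 ^ i` is `R / (J + 𝔪 ^ i)`, so the graded pieces are differences of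
truncated colengths. -/
theorem localHilbertFunction_add_truncatedColength (J : Ideal (PowerSeriesTwo k))
    [Module.Finite k (PowerSeriesTwo k ⧸ J)] (i : ℕ) :
    localHilbertFunction J i + truncatedColength k J i = truncatedColength k J (i + 1) := by
  have key : ∀ i, truncatedColength k J i +
      finrank k ((quotientMaximalIdeal J ^ i).restrictScalars k) =
        finrank k (PowerSeriesTwo k ⧸ J) := by
    intro i
    rw [← Submodule.finrank_quotient_add_finrank ((quotientMaximalIdeal J ^ i).restrictScalars k)]
    congr 1
    rw [quotientMaximalIdeal, ← Ideal.map_pow]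
    exact ((Submodule.Quotient.restrictScalarsEquiv k _).trans
      (DoubleQuot.quotQuotEquivQuotSupₐ k J (maximalIdeal _ ^ i)).toLinearEquiv).finrank_eq.symm
  have hle : (quotientMaximalIdeal J ^ (i + 1)).restrictScalars k ≤
      (quotientMaximalIdeal J ^ i).restrictScalars k :=
    fun x hx => Ideal.pow_le_pow_right (Nat.le_succ i) hx
  have h1 := Submodule.finrank_quotient_add_finrank
    (Submodule.submoduleOf ((quotientMaximalIdeal J ^ (i + 1)).restrictScalars k)
      ((quotientMaximalIdeal J ^ i).restrictScalars k))
  rw [(Submodule.submoduleOfEquivOfLe hle).finrank_eq] at h1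
  have h2 := key i
  have h3 := key (i + 1)
  change localHilbertFunction J i + _ = _ at h1
  omega

theorem MvPowerSeries.X_dvd_of_X_dvd_X_mul {σ : Type*} {s t : σ} (hst : s ≠ t)
    {b : MvPowerSeries σ k} (h : X (R := k) s ∣ X t * b) : X s ∣ b := by
  classical
  rw [X_dvd_iff] at h ⊢
  intro m hm
  have := h (Finsupp.single t 1 + m) (by simp [hm, hst.symm])
  rwa [X, coeff_add_monomial_mul, one_mul] at this

theorem mem_maximalIdeal_iff_constantCoeff {p : PowerSeriesTwo k} :
    p ∈ maximalIdeal (PowerSeriesTwo k) ↔ MvPowerSeries.constantCoeff p = 0 := by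
  rw [mem_maximalIdeal, mem_nonunits_iff, MvPowerSeries.isUnit_iff_constantCoeff, isUnit_iff_ne_zero,
    not_not]

theorem exists_eq_X_mul_add_X_mul {p : PowerSeriesTwo k}
    (hp : MvPowerSeries.constantCoeff p = 0) :
    ∃ a b : PowerSeriesTwo k, p = MvPowerSeries.X 0 * a + MvPowerSeries.X 1 * b := by
  classical
  -- The part of `p` free of `X 0`; having no constant term, it is divisible by `X 1`.
  let q : PowerSeriesTwo k := fun m => if m 0 = 0 then MvPowerSeries.coeff m p else 0
  have hq : ∀ m, MvPowerSeries.coeff m q = if m 0 = 0 then MvPowerSeries.coeff m p else 0 :=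
    fun _ => rfl
  obtain ⟨a, ha⟩ : MvPowerSeries.X 0 ∣ p - q := by
    rw [MvPowerSeries.X_dvd_iff]
    intro m hm
    rw [map_sub, hq, if_pos hm, sub_self]
  obtain ⟨b, hb⟩ : MvPowerSeries.X 1 ∣ q := by
    rw [MvPowerSeries.X_dvd_iff]
    intro m hm
    rw [hq]
    split_ifs with h0
    · have : m = 0 := by
        ext i
        fin_cases i
        · exact h0
        · exact hm
      rw [this, MvPowerSeries.coeff_zero_eq_constantCoeff_apply, hp]
    · rfl
  exact ⟨a, b, by rw [← ha, ← hb]; ring⟩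

theorem isRegularParameterPair_X_sub (c : k) :
    IsRegularParameterPair k (MvPowerSeries.X 0 : PowerSeriesTwo k)
      (MvPowerSeries.X 1 - algebraMap k (PowerSeriesTwo k) c * MvPowerSeries.X 0) where
  span_eq := by
    refine le_antisymm ?_ fun p hp => ?_
    · rw [Ideal.span_le]
      rintro p (rfl | rfl)
      · rw [SetLike.mem_coe, mem_maximalIdeal_iff_constantCoeff]
        simp
      · rw [SetLike.mem_coe, mem_maximalIdeal_iff_constantCoeff]
        simp
    · obtain ⟨a, b, rfl⟩ := exists_eq_X_mul_add_X_mul (mem_maximalIdeal_iff_constantCoeff.1 hp)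
      rw [Ideal.mem_span_pair]
      exact ⟨a + algebraMap k (PowerSeriesTwo k) c * b, b, by ring⟩
  ne_zero := by
    intro h
    have := congrArg (MvPowerSeries.coeff (Finsupp.single 0 1)) h
    simp [MvPowerSeries.coeff_X] at this
  dvd_of_dvd_mul b hb := by
    refine MvPowerSeries.X_dvd_of_X_dvd_X_mul (t := 1) (by decide) ?_
    rw [sub_mul] at hb
    have := dvd_add hb (Dvd.intro (algebraMap k (PowerSeriesTwo k) c * b) rfl)
    convert this using 1
    ring
  finrank_residue := by
    refine finrank_eq_one (Ideal.Quotient.mk _ 1) ?_ fun y => ?_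
    · rw [map_one]
      exact one_ne_zero
    · obtain ⟨p, rfl⟩ := Ideal.Quotient.mk_surjective y
      refine ⟨MvPowerSeries.constantCoeff p, ?_⟩
      rw [← Ideal.Quotient.mkₐ_eq_mk k, ← map_smul, Ideal.Quotient.mkₐ_eq_mk, Ideal.Quotient.eq,
        mem_maximalIdeal_iff_constantCoeff]
      simp

end PowerSeries

/-! ### Hilbert functions of zero-dimensional ideals -/

section ZeroDimensional

variable {k : Type*} [Field k]

instance : IsDomain (PowerSeriesTwo k) := NoZeroDivisors.to_isDomain _

theorem exists_isRegularOfOrder [Infinite k] {d : ℕ} {f : PowerSeriesTwo k}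
    (hf : f ∈ maximalIdeal (PowerSeriesTwo k) ^ d)
    (hf' : f ∉ maximalIdeal (PowerSeriesTwo k) ^ (d + 1)) :
    ∃ v : PowerSeriesTwo k, IsRegularParameterPair k (MvPowerSeries.X 0) v ∧
      IsRegularOfOrder (MvPowerSeries.X 0) v d f := by
  obtain ⟨c, hc⟩ :=
    (finite_setOf_mem_sup_span isRegularParameterPair_X_sub hf hf').infinite_compl.nonempty
  exact ⟨_, isRegularParameterPair_X_sub c, (isRegularParameterPair_X_sub c).isRegularOfOrder hf hc⟩

theorem IsZeroDimensionalIdeal.exists_pow_le {J : Ideal (PowerSeriesTwo k)}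
    (hJ : IsZeroDimensionalIdeal J) : ∃ N, maximalIdeal (PowerSeriesTwo k) ^ N ≤ J := by
  have := hJ.2
  have : IsArtinianRing (PowerSeriesTwo k ⧸ J) := IsArtinianRing.of_finite k _
  exact exists_maximalIdeal_pow_le_of_isArtinianRing_quotient J

theorem IsZeroDimensionalIdeal.exists_order {J : Ideal (PowerSeriesTwo k)}
    (hJ : IsZeroDimensionalIdeal J) : ∃ d, d ≠ 0 ∧ J ≤ maximalIdeal (PowerSeriesTwo k) ^ d ∧
      ¬ J ≤ maximalIdeal (PowerSeriesTwo k) ^ (d + 1) := by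
  obtain ⟨N, hN⟩ := hJ.exists_pow_le
  obtain ⟨d, hd, hd'⟩ := (isRegularParameterPair_X_sub 0).exists_order hN
  refine ⟨d, ?_, hd, hd'⟩
  rintro rfl
  rw [zero_add, pow_one] at hd'
  exact hd' (le_maximalIdeal hJ.1)

theorem IsZeroDimensionalIdeal.exists_localHilbertFunction_eq_zero {J : Ideal (PowerSeriesTwo k)}
    (hJ : IsZeroDimensionalIdeal J) : ∃ N, ∀ i, N ≤ i → localHilbertFunction J i = 0 := by
  have := hJ.2
  obtain ⟨N, hN⟩ := hJ.exists_pow_le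
  refine ⟨N, fun i hi => ?_⟩
  have h1 := localHilbertFunction_add_truncatedColength J i
  have h2 := truncatedColength_eq_of_le (k := k) hN hi
  omega

theorem IsZeroDimensionalIdeal.localHilbertFunction_of_lt {J : Ideal (PowerSeriesTwo k)}
    (hJ : IsZeroDimensionalIdeal J) {d i : ℕ} (hd : J ≤ maximalIdeal (PowerSeriesTwo k) ^ d)
    (hi : i < d) : localHilbertFunction J i = i + 1 := by
  have := hJ.2
  have h1 := localHilbertFunction_add_truncatedColength J i
  have h2 := (isRegularParameterPair_X_sub (0 : k)).truncatedColength_succ_of_le_pow hd hi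
  omega

theorem IsZeroDimensionalIdeal.localHilbertFunction_zero {J : Ideal (PowerSeriesTwo k)}
    (hJ : IsZeroDimensionalIdeal J) : localHilbertFunction J 0 = 1 := by
  obtain ⟨d, hd0, hd, -⟩ := hJ.exists_order
  exact hJ.localHilbertFunction_of_lt hd (Nat.pos_of_ne_zero hd0)

theorem IsZeroDimensionalIdeal.localHilbertFunction_succ_le [Infinite k]
    {J : Ideal (PowerSeriesTwo k)} (hJ : IsZeroDimensionalIdeal J) {d i : ℕ}
    (hd : J ≤ maximalIdeal (PowerSeriesTwo k) ^ d)
    (hd' : ¬ J ≤ maximalIdeal (PowerSeriesTwo k) ^ (d + 1)) (hi : d ≤ i + 1) :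
    localHilbertFunction J (i + 1) ≤ localHilbertFunction J i := by
  have := hJ.2
  obtain ⟨f, hfJ, hf⟩ := SetLike.not_le_iff_exists.1 hd'
  obtain ⟨v, H, hreg⟩ := exists_isRegularOfOrder (hd hfJ) hf
  have h1 := H.truncatedColength_concave hreg hfJ hi
  have h2 := localHilbertFunction_add_truncatedColength J i
  have h3 := localHilbertFunction_add_truncatedColength J (i + 1)
  have h4 : i + 1 + 1 = i + 2 := rfl
  rw [h4] at h3
  omega

/-- Truncated colengths of a proper principal ideal increase strictly, whereas those of `J`
stabilize. -/
theorem IsZeroDimensionalIdeal.ne_span_singleton [Infinite k] {J : Ideal (PowerSeriesTwo k)}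
    (hJ : IsZeroDimensionalIdeal J) (f : PowerSeriesTwo k) : J ≠ Ideal.span {f} := by
  rintro rfl
  obtain ⟨N, hN⟩ := hJ.exists_pow_le
  obtain ⟨d, hd0, hd, hd'⟩ := hJ.exists_order
  rw [Ideal.span_singleton_le_iff_mem] at hd hd'
  obtain ⟨v, H, hreg⟩ := exists_isRegularOfOrder hd hd'
  have h1 := H.truncatedColength_span_singleton_lt hd0 hreg N
  rw [truncatedColength_eq_of_le hN le_rfl] at h1
  exact lt_irrefl _ h1

theorem IsZeroDimensionalIdeal.minGenerators_span_pair [Infinite k] {f g : PowerSeriesTwo k}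
    (hJ : IsZeroDimensionalIdeal (Ideal.span {f, g})) :
    minGenerators (Ideal.span {f, g}) = 2 := by
  have hfg : (Ideal.span {f, g}).FG := Submodule.fg_span (Set.toFinite _)
  have h2 : minGenerators (Ideal.span {f, g}) ≤ 2 :=
    (Submodule.spanFinrank_span_le_ncard_of_finite (Set.toFinite _)).trans 
      ((Set.ncard_insert_le f {g}).trans_eq (by rw [Set.ncard_singleton]))
  have h0 : minGenerators (Ideal.span {f, g}) ≠ 0 := by
    rw [minGenerators, Ne, Submodule.spanFinrank_eq_zero_iff_eq_bot hfg]
    intro h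
    exact hJ.ne_span_singleton 0 (h.trans (Ideal.span_singleton_eq_bot.2 rfl).symm)
  have h1 : minGenerators (Ideal.span {f, g}) ≠ 1 := by
    rw [minGenerators, Ne, Submodule.spanFinrank_eq_one_iff]
    rintro ⟨⟨p, hp⟩, -⟩
    exact hJ.ne_span_singleton p hp
  omega

theorem IsCompleteIntersectionIdeal.exists_eq_span_pair {J : Ideal (PowerSeriesTwo k)}
    (hJ : IsCompleteIntersectionIdeal J) : ∃ f g, J = Ideal.span {f, g} := by
  have h2 : Submodule.spanFinrank J = 2 := hJ.2
  have hfg : J.FG := by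
    by_contra h
    -- `spanFinrank` takes the default value 0 on ideals that are not finitely generated.
    rw [Submodule.spanFinrank_of_not_fg h] at h2
    omega
  have h := Submodule.FG.generators_ncard hfg
  rw [h2, Set.ncard_eq_two] at h
  obtain ⟨f, g, -, h⟩ := h
  exact ⟨f, g, by rw [← h]; exact (Submodule.span_generators J).symm⟩

theorem IsCompleteIntersectionIdeal.jump_le_one [Infinite k] {J : Ideal (PowerSeriesTwo k)}
    (hJ : IsCompleteIntersectionIdeal J) (i : ℕ) :
    ((localHilbertFunction J (i + 1) : ℤ) - (localHilbertFunction J i : ℤ)).natAbs ≤ 1 := by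
  have := hJ.1.2
  obtain ⟨d, -, hd, hd'⟩ := hJ.1.exists_order
  obtain ⟨f, g, rfl, hf, hg, hf'⟩ : ∃ f g, J = Ideal.span {f, g} ∧
      f ∈ maximalIdeal (PowerSeriesTwo k) ^ d ∧ g ∈ maximalIdeal (PowerSeriesTwo k) ^ d ∧
        f ∉ maximalIdeal (PowerSeriesTwo k) ^ (d + 1) := by
    obtain ⟨f, g, rfl⟩ := hJ.exists_eq_span_pair
    rw [Ideal.span_le, Set.pair_subset_iff] at hd hd'
    by_cases hf : f ∈ maximalIdeal (PowerSeriesTwo k) ^ (d + 1)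
    · exact ⟨g, f, by rw [Set.pair_comm], hd.2, hd.1, fun hg => hd' ⟨hf, hg⟩⟩
    · exact ⟨f, g, rfl, hd.1, hd.2, hf⟩
  obtain ⟨v, H, hreg⟩ := exists_isRegularOfOrder hf hf'
  exact H.abs_sub_le_one_of_span_pair hreg hg (localHilbertFunction_add_truncatedColength _) i

/-- The vanishing of `h` at `N` makes the colengths at `N` and `N + 1` agree, so Nakayama yields
finite colength; `h 0 ≠ 0` makes the ideal proper. -/
theorem isCompleteIntersectionIdeal_of_truncatedColength [Infinite k] {f g : PowerSeriesTwo k}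
    {h : ℕ → ℕ} {N : ℕ} (h0 : h 0 ≠ 0) (hN : h N = 0)
    (hL : ∀ i, truncatedColength k (Ideal.span {f, g}) i = ∑ j ∈ Finset.range i, h j) :
    IsCompleteIntersectionIdeal (Ideal.span {f, g}) ∧
      localHilbertFunction (Ideal.span {f, g}) = h := by
  have H := isRegularParameterPair_X_sub (0 : k)
  have hm : (maximalIdeal (PowerSeriesTwo k)).FG := by
    rw [← H.span_eq]
    exact Submodule.fg_span (Set.toFinite _)
  have hle : maximalIdeal (PowerSeriesTwo k) ^ N ≤ Ideal.span {f, g} := by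
    refine pow_le_of_truncatedColength_eq (k := k) hm (H.finite_quotient_sup_pow _ _) ?_
    rw [hL, hL, Finset.sum_range_succ, hN, add_zero]
  have hfin : Module.Finite k (PowerSeriesTwo k ⧸ Ideal.span {f, g}) := by
    have := H.finite_quotient_pow N
    exact quotient_finite_of_le hle
  have hz : IsZeroDimensionalIdeal (Ideal.span {f, g}) := by
    refine ⟨fun htop => ?_, hfin⟩
    have h1 := hL 1
    have : Subsingleton
        (PowerSeriesTwo k ⧸ (Ideal.span {f, g} ⊔ maximalIdeal (PowerSeriesTwo k) ^ 1)) := by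
      rw [Ideal.Quotient.subsingleton_iff, htop, top_sup_eq]
    rw [truncatedColength, finrank_zero_of_subsingleton, Finset.sum_range_one] at h1
    exact h0 h1.symm
  refine ⟨⟨hz, hz.minGenerators_span_pair⟩, funext fun i => ?_⟩
  have h1 := localHilbertFunction_add_truncatedColength (Ideal.span {f, g}) i
  rw [hL, hL, Finset.sum_range_succ] at h1
  omega

end ZeroDimensional

theorem mainTheorem4 (k : Type*) [Field k] [CharZero k] (h : ℕ → ℕ)
    (hh : IsAdmissibleHilbertFunction k h) :
    (∃ J : Ideal (PowerSeriesTwo k),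
      IsCompleteIntersectionIdeal J ∧ localHilbertFunction J = h) ↔ maxJump h = 1 := by
  -- Characteristic zero enters only here, to supply enough slopes for a generic linear form.
  have : Infinite k := Infinite.of_injective _ (Nat.cast_injective (R := k))
  obtain ⟨J₀, hJ₀, rfl⟩ := hh
  obtain ⟨N, hN⟩ := hJ₀.exists_localHilbertFunction_eq_zero
  have h0 := hJ₀.localHilbertFunction_zero
  rw [maxJump_eq_one_iff h0 hN]
  constructor
  · rintro ⟨J, hJ, hJh⟩ i
    rw [← hJh]
    exact hJ.jump_le_one i
  · intro hjump
    obtain ⟨d, hd0, hd, hd'⟩ := hJ₀.exists_order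
    obtain ⟨d, rfl⟩ := Nat.exists_eq_succ_of_ne_zero hd0
    have hlt := fun i => hJ₀.localHilbertFunction_of_lt (i := i) hd
    have hle := fun i => hJ₀.localHilbertFunction_succ_le (i := i) hd hd'
    -- With order `d + 1`, the value at `d` is `d + 1`; monotonicity and the jump bound leave only
    -- `d` or `d + 1` for the next value.
    have h1 := hlt d (Nat.lt_succ_self d)
    have h2 := hle d le_rfl
    have h3 := hjump d
    obtain ⟨f, g, -, -, -, hL⟩ := (isRegularParameterPair_X_sub (0 : k)).exists_span_pair N
      (localHilbertFunction J₀) (d + 1) hlt (by omega) (by omega)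
      (fun i hi => by
        have h4 := hle i (by omega)
        have h5 := hjump i
        omega) hN
    exact ⟨_, isCompleteIntersectionIdeal_of_truncatedColength (by omega) (hN N le_rfl) hL⟩
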